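/- Let $X$ be a real Banach space with topological dual $X^*$ and bidual $X^{**}$, write $\langle x,x^*\rangle=\langle x^*,x\rangle=x^*(x)$ for the duality products, and identify $X$ with its canonical image in $X^{**}$. Operators $T:X\rightrightarrows X^*$ (respectively $X^{**}\rightrightarrows X^*$) are identified with their graphs $T\subset X\times X^*$ (respectively $T\subset X^{**}\times X^*$). Such a $T$ is monotone if $\langle q-q',r-r'\rangle\ge 0$ for all $(q,r),(q',r')\in T$, and maximal monotone if it is maximal, with respect to inclusion, among the monotone subsets of $X\times X^*$ (respectively of $X^{**}\times X^*$). For $f:X\times X^*\to[-\infty,\infty]$ let $f^*:X^*\times X^{**}\to[-\infty,\infty]$, $$f^*(x^*,x^{**})=\sup_{(y,y^*)\in X\times X^*}\big(\langle y,x^*\rangle+\langle y^*,x^{**}\rangle-f(y,y^*)\big),$$ be its conjugate, and let $\operatorname{cl\,conv} f$ be the pointwise supremum of all convex, norm lower semicontinuous functions $h:X\times X^*\to[-\infty,\infty]$ with $h\le f$. Let $\mathcal S_T=\operatorname{cl\,conv}(\pi+\delta_T)$, where $\pi(x,x^*)=\langle x,x^*\rangle$ and $\delta_T$ is $0$ on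 $T$ and $+\infty$ elsewhere. For a Banach space $E$ and $A\subset E\times E^*$ put $$\varphi_A(x,x^*)=\sup_{(y,y^*)\in A}\big(\langle x,y^*\rangle+\langle y,x^*\rangle-\langle y,y^*\rangle\big),\qquad (x,x^*)\in E\times E^*,$$ and let $\mathcal F_A$ be the set of all convex, norm lower semicontinuous functions $h:E\times E^*\to[-\infty,\infty]$ such that $h(x,x^*)\ge\langle x,x^*\rangle$ for all $(x,x^*)\in E\times E^*$, with equality for $(x,x^*)\in A$. (Below, these notions are used with $E=X$ and with $E=X^*$.) Finally, let $\Lambda:X^{**}\times X^*\to X^*\times X^{**}$, $\Lambda(x^{**},x^*)=(x^*,x^{**})$. **Theorem 1.** Let $T:X\rightrightarrows X^*$ be maximal monotone and suppose that $$(\mathcal S_T)^*(x^*,x^{**})\ge\langle x^*,x^{**}\rangle\qquad\text{for all }(x^*,x^{**})\in X^*\times X^{**}.$$ Then: 1. there is exactly one maximal monotone $\widetilde T:X^{**}\rightrightarrows X^*$ with $T\subset\widetilde T$; 2. $(\mathcal S_T)^*=\varphi_{\Lambda\widetilde T}$ on $X^*\times X^{**}$; 3. for every $h\in\mathcal F_T$,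 one has $h^*(x^*,x^{**})\ge\langle x^*,x^{**}\rangle$ for all $(x^*,x^{**})\in X^*\times X^{**}$, and $h^*\in\mathcal F_{\Lambda\widetilde T}$; 4. $T$ has the restricted Brøndsted–Rockafellar property: whenever $\varepsilon\ge 0$ and $(x,x^*)\in X\times X^*$ satisfy $\langle x-y,x^*-y^*\rangle\ge-\varepsilon$ for all $(y,y^*)\in T$, then for all $\tilde\varepsilon>\varepsilon$ and $\lambda>0$ there is $(\bar x,\bar x^*)\in T$ with $\|x-\bar x\|<\lambda$ and $\|\bar x^*-x^*\|<\tilde\varepsilon/\lambda$. -/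

import Mathlib

namespace BidualExtension

/-! ### Monotone operators

A point-to-set operator is identified with its graph.  Monotonicity is defined for subsets of
`E × F`, with respect to a duality product `B : E → F → ℝ`. -/

section Monotone

variable {E F : Type*} [AddGroup E] [AddGroup F]

/-- `⟨q - q', r - r'⟩ ≥ 0` for all `(q, r), (q', r') ∈ A`. -/
def IsMonotone (B : E → F → ℝ) (A : Set (E × F)) : Prop :=
  ∀ p ∈ A, ∀ q ∈ A, 0 ≤ B (p.1 - q.1) (p.2 - q.2)

/-- Monotone, and maximal with respect to inclusion among all monotone subsets of `E × F`. -/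
def IsMaximalMonotone (B : E → F → ℝ) (A : Set (E × F)) : Prop :=
  Maximal (IsMonotone B) A

end Monotone

/-! ### Convex lower semicontinuous functions with values in `[-∞, +∞]` -/

section Convex

variable {E : Type*} [NormedAddCommGroup E] [NormedSpace ℝ E]

/-- An extended-real-valued function is convex if its epigraph is convex. -/
def IsConvexFun (f : E → EReal) : Prop :=
  Convex ℝ {p : E × ℝ | f p.1 ≤ (p.2 : EReal)}

/-- The convex closure: the pointwise supremum of all convex lower semicontinuous functions
majorized by `f`. -/
noncomputable def clConv (f : E → EReal) (x : E) : EReal :=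
  ⨆ (h : E → EReal) (_ : IsConvexFun h ∧ LowerSemicontinuous h ∧ ∀ y, h y ≤ f y), h x

/-- The conjugate `f*(u) = sup_x (⟨x, u⟩ - f x)`, defined on the topological dual. -/
noncomputable def conjugate (f : E → EReal) (u : StrongDual ℝ E) : EReal :=
  ⨆ x : E, ((u x : ℝ) : EReal) - f x

open Classical in
/-- The indicator function: `0` on `A` and `+∞` outside `A`. -/
noncomputable def indicatorFun (A : Set E) (x : E) : EReal :=
  if x ∈ A then 0 else ⊤

end Convex

section Pairing

variable {X : Type*} [NormedAddCommGroup X] [NormedSpace ℝ X]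

/-- The duality product `⟨x, x*⟩ = x*(x)` on `X × X*`. -/
noncomputable def pairing (x : X) (u : StrongDual ℝ X) : ℝ := u x

/-- The duality product `⟨x**, x*⟩ = x**(x*)` on `X** × X*`. -/
noncomputable def bidualPairing (z : StrongDual ℝ (StrongDual ℝ X)) (u : StrongDual ℝ X) : ℝ := z u

/-- The conjugate of a function on `X × X*`, as a function on `X* × X**`: the pair `(x*, x**)` is
the functional `(y, y*) ↦ ⟨y, x*⟩ + ⟨y*, x**⟩` on `X × X*`. -/
noncomputable def prodConjugate (h : X × StrongDual ℝ X → EReal)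
    (q : StrongDual ℝ X × StrongDual ℝ (StrongDual ℝ X)) : EReal :=
  conjugate h (q.1.coprod q.2)

/-- The Fitzpatrick function
`φ_A(x, x*) = sup_{(y, y*) ∈ A} ⟨x, y*⟩ + ⟨y, x*⟩ - ⟨y, y*⟩` of a subset `A` of `X × X*`. -/
noncomputable def fitzpatrickFun (A : Set (X × StrongDual ℝ X))
    (p : X × StrongDual ℝ X) : EReal :=
  ⨆ q ∈ A, ((pairing p.1 q.2 + pairing q.1 p.2 - pairing q.1 q.2 : ℝ) : EReal)

/-- The `S`-function of a subset `A` of `X × X*`: the convex closure of the duality product plus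
the indicator function of `A`. -/
noncomputable def sFun (A : Set (X × StrongDual ℝ X)) : X × StrongDual ℝ X → EReal :=
  clConv (fun p => ((pairing p.1 p.2 : ℝ) : EReal) + indicatorFun A p)

/-- The Fitzpatrick family of `A ⊆ X × X*`: the convex, (norm) lower semicontinuous functions on
`X × X*` that majorize the duality product and coincide with it on `A`. -/
def fitzpatrickFamily (A : Set (X × StrongDual ℝ X)) : Set (X × StrongDual ℝ X → EReal) :=
  {h | IsConvexFun h ∧ LowerSemicontinuous h ∧
    (∀ p, ((pairing p.1 p.2 : ℝ) : EReal) ≤ h p) ∧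
    ∀ p ∈ A, h p = ((pairing p.1 p.2 : ℝ) : EReal)}

/-- `T' : X** ⇉ X*` is a maximal monotone extension of `T : X ⇉ X*`, where `X` is embedded into
`X**` by the canonical injection. -/
def IsMaximalMonotoneExtension (T : Set (X × StrongDual ℝ X))
    (T' : Set (StrongDual ℝ (StrongDual ℝ X) × StrongDual ℝ X)) : Prop :=
  IsMaximalMonotone bidualPairing T' ∧
    ∀ p ∈ T, (NormedSpace.inclusionInDoubleDual ℝ X p.1, p.2) ∈ T'

/-- The image of `A ⊆ X** × X*` under `Λ(x**, x*) = (x*, x**)`. -/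
def lam (A : Set (StrongDual ℝ (StrongDual ℝ X) × StrongDual ℝ X)) :
    Set (StrongDual ℝ X × StrongDual ℝ (StrongDual ℝ X)) :=
  Prod.swap '' A

/-- The enlargement
`T^ε(x) = {x* | ⟨x - y, x* - y*⟩ ≥ -ε for all (y, y*) ∈ T}`. -/
def enlargement (T : Set (X × StrongDual ℝ X)) (ε : ℝ) (x : X) : Set (StrongDual ℝ X) :=
  {u | ∀ q ∈ T, -ε ≤ pairing (x - q.1) (u - q.2)}

/-- The restricted Brøndsted–Rockafellar property. -/
def HasRestrictedBRProperty (T : Set (X × StrongDual ℝ X)) : Prop :=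
  ∀ ε : ℝ, 0 ≤ ε → ∀ (x : X) (u : StrongDual ℝ X), u ∈ enlargement T ε x →
    ∀ ε' : ℝ, ε < ε' → ∀ l : ℝ, 0 < l →
      ∃ p ∈ T, ‖x - p.1‖ < l ∧ ‖p.2 - u‖ < ε' / l

end Pairing

end BidualExtension

open BidualExtension

/-!
The conjugate of `S_T` at `(u, z)` is `F(u, z) = sup_{(y, v) ∈ T} u y + z v - v y`
(`prodConjugate_sFun`), so the hypothesis says that the convex function `F` majorizes the duality
product of `X* × X**`; this is `IsNI` below.

*The extension.* A point `(z, u)` of `X** × X*` is monotonically related to `T` if and only if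
`F(u, z) ≤ z u`. Let `R` (`bidualRelated T`) be the set of these points. A convex function that
majorizes the duality product lies, at every point `(v, w)`, above `z v + w u - z u` whenever it
does not exceed the duality product at `(u, z)`: compare the two functions on the segment from
`(u, z)` to `(v, w)` and let the second endpoint's weight tend to `0` (`sub_le_of_segment_bound`,
`IsNI.le_of_mem_bidualRelated`). Taking `(w, v) ∈ R` gives the monotonicity of `R`, so `R` is the
only maximal monotone extension of `T`. The same inequality says that the Fitzpatrick function of
`R` is at most `F`. It also yields `h* ≤ ⟨·, ·⟩` on `R` for `h` in the Fitzpatrick family of `T`,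
since such an `h` majorizes the Fitzpatrick function of `T`.

*The restricted Brøndsted–Rockafellar property.* Let `φ` be the Fitzpatrick function of `T`,
translated so that the given point is the origin. If `φ + a/2 ‖x‖² + 1/(2a) ‖u‖²` were bounded
below by some `δ > 0`, a Hahn–Banach separation (Fenchel duality) would give a functional `(u, z)`
contradicting `F(u, z) ≥ z u`. Hence this sum takes values below every `δ > 0`
(`IsNI.exists_fitzpatrick_add_sq_norm_le`). If the origin lies in `T^ε`, convexity of `φ` on the
segment from the origin to such a point gives `a ‖x‖² ≤ ε + o(1)` and `‖u‖² / a ≤ ε + o(1)`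
(`IsNI.exists_near_zero`). Iterating with gaps tending to `0` geometrically gives a Cauchy sequence,
whose limit lies in `T` by maximality; the weight `a = ε' / l²` yields the required estimates.
-/

namespace BidualExtension

open Set Filter Topology

/-! ### Operators of negative infimum type and their extension to the bidual -/

section BidualExtensionProof

variable {X : Type*} [NormedAddCommGroup X] [NormedSpace ℝ X]

/-- `T` is of negative infimum type: `sup_{q ∈ T} (u q₁ + z q₂ - q₂ q₁) ≥ z u` for all
`(u, z) ∈ X* × X**`, that is, `inf_{q ∈ T} ⟨z - q₁, u - q₂⟩ ≤ 0`. The supremum may be `+∞`, so the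
inequality is stated through the real upper bounds `c` of the set. -/
def IsNI (T : Set (X × StrongDual ℝ X)) : Prop :=
  ∀ (u : StrongDual ℝ X) (z : StrongDual ℝ (StrongDual ℝ X)) (c : ℝ),
    (∀ q ∈ T, u q.1 + z q.2 - q.2 q.1 ≤ c) → z u ≤ c

/-- The points `(z, u)` of `X** × X*` that are monotonically related to `T`; the condition is
`0 ≤ ⟨z - q₁, u - q₂⟩` for all `q ∈ T`, expanded. -/
def bidualRelated (T : Set (X × StrongDual ℝ X)) :
    Set (StrongDual ℝ (StrongDual ℝ X) × StrongDual ℝ X) :=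
  {p | ∀ q ∈ T, p.2 q.1 + p.1 q.2 - q.2 q.1 ≤ p.1 p.2}

/-- For a bilinear form `B`, the hypothesis with `α = B q q`, `β = B q p + B p q`, `γ = B p p` says
that `t ↦ (1 - t) B(q, q) + t c` majorizes `B` on the segment from `q` to `p`; the conclusion compares
the slopes at `t = 0`. -/
lemma sub_le_of_segment_bound {α β γ c : ℝ}
    (h : ∀ t : ℝ, 0 < t → t < 1 →
      (1 - t) ^ 2 * α + t * (1 - t) * β + t ^ 2 * γ ≤ (1 - t) * α + t * c) :
    β - α ≤ c := by
  have hlim : Tendsto (fun t : ℝ => (1 - t) * (β - α) + t * γ) (𝓝[>] 0) (𝓝 (β - α)) := by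
    have : Continuous fun t : ℝ => (1 - t) * (β - α) + t * γ := by fun_prop
    simpa using (this.tendsto 0).mono_left nhdsWithin_le_nhds
  refine le_of_tendsto hlim ?_
  filter_upwards [Ioo_mem_nhdsGT (zero_lt_one' ℝ)] with t ht
  have := h t ht.1 ht.2
  refine le_of_mul_le_mul_left ?_ ht.1
  linarith

/-- With `c` ranging over the upper bounds of the affine functions given by `T`, this says that the
Fitzpatrick function of `bidualRelated T` is at most that of `T`, both on `X* × X**`. -/
lemma IsNI.le_of_mem_bidualRelated {T : Set (X × StrongDual ℝ X)} (hT : IsNI T)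
    {z w : StrongDual ℝ (StrongDual ℝ X)} {u v : StrongDual ℝ X} (hp : (z, u) ∈ bidualRelated T)
    {c : ℝ} (hc : ∀ q ∈ T, v q.1 + w q.2 - q.2 q.1 ≤ c) :
    z v + w u - z u ≤ c := by
  refine sub_le_of_segment_bound (γ := w v) fun t h0 h1 => ?_
  have := hT ((1 - t) • u + t • v) ((1 - t) • z + t • w) ((1 - t) * z u + t * c) ?_
  · simp only [map_add, map_smul, add_apply, smul_apply,
      smul_eq_mul] at this
    linarith
  · intro q hq
    have e1 := mul_le_mul_of_nonneg_left (hp q hq) (sub_nonneg.2 h1.le)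
    have e2 := mul_le_mul_of_nonneg_left (hc q hq) h0.le
    simp only [add_apply, smul_apply,
      smul_eq_mul] at e1 e2 ⊢
    linarith

lemma IsNI.isMonotone_bidualRelated {T : Set (X × StrongDual ℝ X)} (hT : IsNI T) :
    IsMonotone bidualPairing (bidualRelated T) := by
  rintro ⟨z, u⟩ hp ⟨w, v⟩ hq
  have := hT.le_of_mem_bidualRelated hp hq
  simp only [bidualPairing, map_sub, sub_apply]
  linarith

lemma mem_bidualRelated_of_monotone {T : Set (X × StrongDual ℝ X)}
    {A : Set (StrongDual ℝ (StrongDual ℝ X) × StrongDual ℝ X)} (hA : IsMonotone bidualPairing A)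
    (hTA : ∀ p ∈ T, (NormedSpace.inclusionInDoubleDual ℝ X p.1, p.2) ∈ A) :
    A ⊆ bidualRelated T := by
  intro p hp q hq
  have := hA p hp _ (hTA q hq)
  simp only [bidualPairing, map_sub, sub_apply,
    NormedSpace.dual_def] at this
  linarith

lemma inclusion_mem_bidualRelated {T : Set (X × StrongDual ℝ X)} (hT : IsMonotone pairing T) :
    ∀ p ∈ T, (NormedSpace.inclusionInDoubleDual ℝ X p.1, p.2) ∈ bidualRelated T := by
  intro p hp q hq
  have := hT p hp q hq
  simp only [pairing, map_sub, sub_apply, NormedSpace.dual_def] at this ⊢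
  linarith

lemma IsNI.isMaximalMonotoneExtension_iff {T : Set (X × StrongDual ℝ X)} (hT : IsNI T)
    (hm : IsMonotone pairing T)
    (A : Set (StrongDual ℝ (StrongDual ℝ X) × StrongDual ℝ X)) :
    IsMaximalMonotoneExtension T A ↔ A = bidualRelated T := by
  constructor
  · rintro ⟨hA, hTA⟩
    exact hA.eq_of_subset hT.isMonotone_bidualRelated (mem_bidualRelated_of_monotone hA.prop hTA)
  · rintro rfl
    refine ⟨⟨hT.isMonotone_bidualRelated, fun B hB hAB => ?_⟩, inclusion_mem_bidualRelated hm⟩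
    exact mem_bidualRelated_of_monotone hB fun p hp => hAB (inclusion_mem_bidualRelated hm p hp)

lemma mem_of_forall_nonneg {T : Set (X × StrongDual ℝ X)} (hT : IsMaximalMonotone pairing T)
    {p : X × StrongDual ℝ X} (hp : ∀ q ∈ T, 0 ≤ (p.2 - q.2) (p.1 - q.1)) : p ∈ T := by
  refine hT.le_of_ge (y := insert p T) ?_ (subset_insert p T) (mem_insert p T)
  rintro q (rfl | hq) r (rfl | hr)
  · simp [pairing]
  · exact hp r hr
  · have := hp q hq
    simp only [pairing, map_sub, sub_apply] at this ⊢
    linarith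
  · exact hT.prop q hq r hr

/-! ### Conjugates and the Fitzpatrick family -/

lemma conjugate_anti {E : Type*} [NormedAddCommGroup E] [NormedSpace ℝ E] {f g : E → EReal}
    (h : ∀ x, f x ≤ g x) (p : StrongDual ℝ E) : conjugate g p ≤ conjugate f p :=
  iSup_mono fun x => EReal.sub_le_sub le_rfl (h x)

lemma conjugate_clConv {E : Type*} [NormedAddCommGroup E] [NormedSpace ℝ E] (f : E → EReal)
    (p : StrongDual ℝ E) : conjugate (clConv f) p = conjugate f p := by
  refine le_antisymm ?_ (conjugate_anti (fun x => iSup₂_le fun h hh => hh.2.2 x) p)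
  rw [← EReal.le_of_forall_lt_iff_le]
  intro c hc
  refine iSup_le fun x => ?_
  -- the affine function `p - c` is one of those whose supremum is `clConv f`
  have hle : ((p x - c : ℝ) : EReal) ≤ clConv f x := by
    refine le_iSup₂_of_le (fun y => ((p y - c : ℝ) : EReal)) ⟨?_, ?_, fun y => ?_⟩ le_rfl
    · simp only [IsConvexFun, EReal.coe_le_coe_iff]
      intro a ha b hb s t hs ht hst
      simp only [mem_ofPred_eq, Prod.fst_add, Prod.snd_add, Prod.smul_fst, Prod.smul_snd, map_add,
        map_smul, smul_eq_mul] at *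
      have e1 := mul_le_mul_of_nonneg_left ha hs
      have e2 := mul_le_mul_of_nonneg_left hb ht
      have : c = s * c + t * c := by rw [← add_mul, hst, one_mul]
      linarith
    · exact (continuous_coe_real_ereal.comp (p.continuous.sub continuous_const)).lowerSemicontinuous
    · have := (le_iSup (fun x => ((p x : ℝ) : EReal) - f x) y).trans hc.le
      beta_reduce at this ⊢
      generalize f y = a at *
      induction a with
      | bot => simp at this
      | top => simp
      | coe a => norm_cast at *; linarith
  generalize clConv f x = a at *
  induction a with
  | bot => exact absurd hle (EReal.bot_lt_coe _).not_ge
  | top => simp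
  | coe a => norm_cast at *; linarith

lemma prodConjugate_sFun (T : Set (X × StrongDual ℝ X)) (u : StrongDual ℝ X)
    (z : StrongDual ℝ (StrongDual ℝ X)) :
    prodConjugate (sFun T) (u, z) = ⨆ q ∈ T, ((u q.1 + z q.2 - q.2 q.1 : ℝ) : EReal) := by
  rw [prodConjugate, sFun, conjugate_clConv]
  refine iSup_congr fun q => ?_
  by_cases hq : q ∈ T
  · simp [hq, indicatorFun, pairing]
  · simp [hq, indicatorFun]

lemma isNI_of_le_prodConjugate {T : Set (X × StrongDual ℝ X)}
    (hS : ∀ (u : StrongDual ℝ X) (z : StrongDual ℝ (StrongDual ℝ X)),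
      ((pairing u z : ℝ) : EReal) ≤ prodConjugate (sFun T) (u, z)) : IsNI T := by
  intro u z c hc
  have := hS u z
  rw [prodConjugate_sFun] at this
  exact EReal.coe_le_coe_iff.1 (this.trans (iSup₂_le fun q hq => EReal.coe_le_coe_iff.2 (hc q hq)))

lemma IsNI.prodConjugate_sFun_eq {T : Set (X × StrongDual ℝ X)} (hT : IsNI T)
    (hm : IsMonotone pairing T) :
    prodConjugate (sFun T) = fitzpatrickFun (lam (bidualRelated T)) := by
  funext ⟨v, w⟩
  rw [prodConjugate_sFun]
  refine le_antisymm (iSup₂_le fun q hq => ?_) ?_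
  · refine le_iSup₂_of_le (q.2, NormedSpace.inclusionInDoubleDual ℝ X q.1)
      ⟨_, inclusion_mem_bidualRelated hm q hq, rfl⟩ ?_
    simp [pairing]
  · refine iSup₂_le ?_
    rintro _ ⟨⟨z, u⟩, hp, rfl⟩
    rw [← EReal.le_of_forall_lt_iff_le]
    intro c hc
    refine EReal.coe_le_coe_iff.2 (hT.le_of_mem_bidualRelated hp fun q hq => ?_)
    exact EReal.coe_le_coe_iff.1 ((le_iSup₂ (f := fun (q : X × StrongDual ℝ X) (_ : q ∈ T) =>
      ((v q.1 + w q.2 - q.2 q.1 : ℝ) : EReal)) q hq).trans hc.le)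

lemma pairing_le_prodConjugate {T : Set (X × StrongDual ℝ X)}
    (hS : ∀ (u : StrongDual ℝ X) (z : StrongDual ℝ (StrongDual ℝ X)),
      ((pairing u z : ℝ) : EReal) ≤ prodConjugate (sFun T) (u, z))
    {h : X × StrongDual ℝ X → EReal} (hh : h ∈ fitzpatrickFamily T)
    (u : StrongDual ℝ X) (z : StrongDual ℝ (StrongDual ℝ X)) :
    ((pairing u z : ℝ) : EReal) ≤ prodConjugate h (u, z) := by
  refine (hS u z).trans (conjugate_anti (fun p => ?_) _)
  refine le_iSup₂_of_le h ⟨hh.1, hh.2.1, fun q => ?_⟩ le_rfl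
  by_cases hq : q ∈ T
  · simp [indicatorFun, hq, hh.2.2.2 q hq]
  · simp [indicatorFun, hq]

lemma isConvexFun_prodConjugate (h : X × StrongDual ℝ X → EReal) :
    IsConvexFun (prodConjugate h) := by
  have : {p : (StrongDual ℝ X × StrongDual ℝ (StrongDual ℝ X)) × ℝ |
      prodConjugate h p.1 ≤ (p.2 : EReal)} =
      ⋂ x, {p | (((p.1.1.coprod p.1.2) x : ℝ) : EReal) - h x ≤ (p.2 : EReal)} := by
    ext p
    simp [prodConjugate, conjugate, iSup_le_iff]
  rw [IsConvexFun, this]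
  refine convex_iInter fun x => ?_
  generalize h x = a
  induction a with
  | bot => simp [convex_empty]
  | top => simp [convex_univ]
  | coe c =>
    intro a ha b hb s t hs ht hst
    simp only [mem_ofPred_eq, ← EReal.coe_sub, EReal.coe_le_coe_iff,
      ContinuousLinearMap.coprod_apply, Prod.fst_add, Prod.snd_add, Prod.smul_fst, Prod.smul_snd,
      add_apply, smul_apply, smul_eq_mul] at *
    have e1 := mul_le_mul_of_nonneg_left ha hs
    have e2 := mul_le_mul_of_nonneg_left hb ht
    have : c = s * c + t * c := by rw [← add_mul, hst, one_mul]
    linarith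

lemma lowerSemicontinuous_prodConjugate (h : X × StrongDual ℝ X → EReal) :
    LowerSemicontinuous (prodConjugate h) := by
  refine lowerSemicontinuous_iSup fun x => ?_
  generalize h x = a
  induction a with
  | bot => simpa using lowerSemicontinuous_const
  | top => simpa using lowerSemicontinuous_const
  | coe c =>
    simp only [← EReal.coe_sub, ContinuousLinearMap.coprod_apply]
    refine (continuous_coe_real_ereal.comp ?_).lowerSemicontinuous
    fun_prop

/-- The members of the Fitzpatrick family of `T` majorize the Fitzpatrick function of `T`. -/
lemma le_of_mem_fitzpatrickFamily {T : Set (X × StrongDual ℝ X)}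
    {h : X × StrongDual ℝ X → EReal} (hh : h ∈ fitzpatrickFamily T) {p q : X × StrongDual ℝ X}
    (hq : q ∈ T) {c : ℝ} (hc : h p ≤ c) :
    p.2 q.1 + q.2 p.1 - q.2 q.1 ≤ c := by
  refine sub_le_of_segment_bound (γ := p.2 p.1) fun t h0 h1 => ?_
  have hmem := hh.1 (x := (q, q.2 q.1)) (hh.2.2.2 q hq).le (y := (p, c)) hc
    (sub_nonneg.2 h1.le) h0.le (sub_add_cancel 1 t)
  have := EReal.coe_le_coe_iff.1 ((hh.2.2.1 _).trans hmem)
  simp only [pairing, Prod.fst_add, Prod.snd_add, Prod.smul_fst, Prod.smul_snd, map_add, map_smul,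
    add_apply, smul_apply, smul_eq_mul] at this
  linarith

lemma IsNI.prodConjugate_le {T : Set (X × StrongDual ℝ X)} (hT : IsNI T)
    {h : X × StrongDual ℝ X → EReal} (hh : h ∈ fitzpatrickFamily T)
    {z : StrongDual ℝ (StrongDual ℝ X)} {u : StrongDual ℝ X} (hp : (z, u) ∈ bidualRelated T) :
    prodConjugate h (u, z) ≤ ((z u : ℝ) : EReal) := by
  refine iSup_le fun p => ?_
  have hlow := hh.2.2.1 p
  have key := fun (c : ℝ) (hc : h p ≤ c) =>
    hT.le_of_mem_bidualRelated (w := NormedSpace.inclusionInDoubleDual ℝ X p.1) (v := p.2) (c := c)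
      hp fun q hq => by simpa using le_of_mem_fitzpatrickFamily hh hq hc
  generalize h p = a at *
  induction a with
  | bot => simp at hlow
  | top => simp
  | coe c =>
    have := key c le_rfl
    simp only [NormedSpace.dual_def, ContinuousLinearMap.coprod_apply] at this ⊢
    norm_cast
    linarith

lemma IsNI.prodConjugate_mem_fitzpatrickFamily {T : Set (X × StrongDual ℝ X)} (hT : IsNI T)
    {h : X × StrongDual ℝ X → EReal} (hh : h ∈ fitzpatrickFamily T)
    (hle : ∀ (u : StrongDual ℝ X) (z : StrongDual ℝ (StrongDual ℝ X)),
      ((pairing u z : ℝ) : EReal) ≤ prodConjugate h (u, z)) :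
    prodConjugate h ∈ fitzpatrickFamily (lam (bidualRelated T)) := by
  refine ⟨isConvexFun_prodConjugate h, lowerSemicontinuous_prodConjugate h,
    fun p => hle p.1 p.2, ?_⟩
  rintro _ ⟨⟨z, u⟩, hp, rfl⟩
  exact le_antisymm (hT.prodConjugate_le hh hp) (hle u z)

/-! ### The restricted Brøndsted–Rockafellar property -/

/-- The conjugate of `a/2 ‖·‖²` is at least `1/(2a) ‖·‖²`. -/
lemma sq_norm_le_of_forall {E : Type*} [NormedAddCommGroup E] [NormedSpace ℝ E]
    (u : StrongDual ℝ E) {a C : ℝ} (ha : 0 < a)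
    (h : ∀ x : E, u x - a / 2 * ‖x‖ ^ 2 ≤ C) : ‖u‖ ^ 2 ≤ 2 * a * C := by
  have hC : 0 ≤ C := by simpa using h 0
  have : ‖u‖ ≤ √(2 * a * C) := by
    refine u.opNorm_le_bound (Real.sqrt_nonneg _) fun x => ?_
    have hd : discrim (a / 2 * ‖x‖ ^ 2) (-u x) C ≤ 0 := by
      refine discrim_le_zero fun t => ?_
      have := h (t • x)
      simp only [map_smul, smul_eq_mul, norm_smul, mul_pow, Real.norm_eq_abs, sq_abs] at this
      linarith
    rw [Real.norm_eq_abs, ← Real.sqrt_sq (norm_nonneg x), ← Real.sqrt_mul (by positivity)]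
    refine Real.abs_le_sqrt ?_
    simp only [discrim, neg_sq] at hd
    linarith
  calc ‖u‖ ^ 2 ≤ √(2 * a * C) ^ 2 := by gcongr
    _ = 2 * a * C := Real.sq_sqrt (by positivity)

/-- The left-hand side is the term of index `q` in the Fitzpatrick function of `T` at `p`, plus half
the square of a weighted norm. The sum is a convex function whose infimum is at most `0`, by Fenchel
duality: a positive lower bound would produce a functional `(u, z)` at which the conjugate is less
than `z u`. -/
lemma IsNI.exists_fitzpatrick_add_sq_norm_le {T : Set (X × StrongDual ℝ X)} (hT : IsNI T)
    (hm : IsMonotone pairing T) {a δ : ℝ} (ha : 0 < a) (hδ : 0 < δ) :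
    ∃ p : X × StrongDual ℝ X, ∀ q ∈ T, q.2 p.1 + p.2 q.1 - q.2 q.1 +
      (a / 2 * ‖p.1‖ ^ 2 + 1 / (2 * a) * ‖p.2‖ ^ 2) ≤ δ := by
  by_contra! hcon
  let N : X × StrongDual ℝ X → ℝ := fun p => a / 2 * ‖p.1‖ ^ 2 + 1 / (2 * a) * ‖p.2‖ ^ 2
  have hNc : Continuous N := by fun_prop
  have hN : ConvexOn ℝ univ N := by
    have h1 : ConvexOn ℝ univ fun p : X × StrongDual ℝ X => ‖p.1‖ ^ 2 :=
      ((convexOn_univ_norm (E := X)).comp_linearMap (LinearMap.fst ℝ X (StrongDual ℝ X))).pow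
        (fun _ _ => norm_nonneg _) 2
    have h2 : ConvexOn ℝ univ fun p : X × StrongDual ℝ X => ‖p.2‖ ^ 2 :=
      ((convexOn_univ_norm (E := StrongDual ℝ X)).comp_linearMap
        (LinearMap.snd ℝ X (StrongDual ℝ X))).pow (fun _ _ => norm_nonneg _) 2
    exact (h1.smul (c := a / 2) (by positivity)).add (h2.smul (c := 1 / (2 * a)) (by positivity))
  -- the open strict hypograph of `δ - N` is separated from the epigraph of the Fitzpatrick function
  let H : Set ((X × StrongDual ℝ X) × ℝ) := {p | p.2 < δ - N p.1}
  let G : Set ((X × StrongDual ℝ X) × ℝ) :=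
    {p | ∀ q ∈ T, q.2 p.1.1 + p.1.2 q.1 - q.2 q.1 ≤ p.2}
  have hHo : IsOpen H := isOpen_lt (by fun_prop) (by fun_prop)
  have hHc : Convex ℝ H := by
    intro p hp q hq s t hs ht hst
    have hconv := hN.2 (mem_univ p.1) (mem_univ q.1) hs ht hst
    have hp' : p.2 < δ - N p.1 := hp
    have hq' : q.2 < δ - N q.1 := hq
    change s * p.2 + t * q.2 < δ - N (s • p.1 + t • q.1)
    simp only [smul_eq_mul] at hconv
    have hδ' : δ = s * δ + t * δ := by rw [← add_mul, hst, one_mul]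
    rcases hs.eq_or_lt with rfl | hs
    · have : t = 1 := by linarith
      subst this
      linarith
    · have e1 := mul_lt_mul_of_pos_left hp' hs
      have e2 := mul_le_mul_of_nonneg_left hq'.le ht
      linarith
  have hGc : Convex ℝ G := by
    intro p hp r hr s t hs ht hst q hq
    have e1 := mul_le_mul_of_nonneg_left (hp q hq) hs
    have e2 := mul_le_mul_of_nonneg_left (hr q hq) ht
    simp only [Prod.fst_add, Prod.snd_add, Prod.smul_fst, Prod.smul_snd, map_add, map_smul,
      add_apply, smul_apply, smul_eq_mul]
    have : q.2 q.1 = s * q.2 q.1 + t * q.2 q.1 := by rw [← add_mul, hst, one_mul]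
    linarith
  have hdisj : Disjoint H G := by
    refine disjoint_left.2 fun p hpH hpG => ?_
    obtain ⟨q, hq, hlt⟩ := hcon p.1
    have e1 := hpG q hq
    have e2 : p.2 < δ - N p.1 := hpH
    simp only [N] at e2
    linarith
  obtain ⟨f, c, hfH, hfG⟩ := geometric_hahn_banach_open hHc hHo hGc hdisj
  have hT0 : T.Nonempty := by
    by_contra hne
    have := hT 0 0 (-1) fun q hq => absurd ⟨q, hq⟩ hne
    norm_num at this
  -- by monotonicity the Fitzpatrick function is at most the duality product on `T`
  have hGmem : ∀ q ∈ T, (q, q.2 q.1) ∈ G := by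
    intro q hq r hr
    have := hm q hq r hr
    simp only [pairing, map_sub, sub_apply] at this
    linarith
  let g : X × StrongDual ℝ X →L[ℝ] ℝ := f.comp (ContinuousLinearMap.inl ℝ (X × StrongDual ℝ X) ℝ)
  let s : ℝ := f (0, 1)
  have hf : ∀ p r, f (p, r) = g p + r * s := by
    intro p r
    have : (p, r) = ((p, 0) : (X × StrongDual ℝ X) × ℝ) + r • (0, 1) := by simp
    rw [this, map_add, map_smul]
    rfl
  have hH : ∀ p, g p + (δ - N p) * s ≤ c := by
    intro p
    have hlim : Tendsto (fun r : ℝ => g p + r * s) (𝓝[<] (δ - N p)) (𝓝 (g p + (δ - N p) * s)) := by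
      have : Continuous fun r : ℝ => g p + r * s := by fun_prop
      exact (this.tendsto _).mono_left nhdsWithin_le_nhds
    refine le_of_tendsto hlim ?_
    filter_upwards [self_mem_nhdsWithin] with r hr
    rw [← hf]
    exact (hfH (p, r) hr).le
  obtain ⟨q₀, hq₀⟩ := hT0
  -- the separating hyperplane is not vertical
  have hs : 0 < s := by
    have e1 := hfG _ (hGmem q₀ hq₀)
    have e2 := hfH (q₀, min (q₀.2 q₀.1) (δ - N q₀) - 1)
      (by
        change min (q₀.2 q₀.1) (δ - N q₀) - 1 < δ - N q₀
        linarith [min_le_right (q₀.2 q₀.1) (δ - N q₀)])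
    rw [hf] at e1 e2
    have e3 := e2.trans_le e1
    have e4 := min_le_left (q₀.2 q₀.1) (δ - N q₀)
    by_contra! hs
    nlinarith
  let u : StrongDual ℝ X := -(s⁻¹ • g.comp (ContinuousLinearMap.inl ℝ X (StrongDual ℝ X)))
  let z : StrongDual ℝ (StrongDual ℝ X) :=
    -(s⁻¹ • g.comp (ContinuousLinearMap.inr ℝ X (StrongDual ℝ X)))
  have hg : ∀ p, g p = -(s * (u p.1 + z p.2)) := by
    intro p
    have : p = (p.1, 0) + (0, p.2) := by simp
    conv_lhs => rw [this, map_add]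
    simp only [u, z, neg_apply, smul_apply,
      ContinuousLinearMap.comp_apply, ContinuousLinearMap.inl_apply,
      ContinuousLinearMap.inr_apply, smul_eq_mul]
    field_simp
    ring
  have hzu : z u ≤ -(c / s) := by
    refine hT u z _ fun q hq => ?_
    have := hfG _ (hGmem q hq)
    rw [hf, hg] at this
    rw [← neg_div, le_div_iff₀ hs]
    linarith
  have hnorm : ‖-u‖ ^ 2 ≤ 2 * a * (c / s - δ + z u + 1 / (2 * a) * ‖u‖ ^ 2) := by
    refine sq_norm_le_of_forall _ ha fun x => ?_
    -- the points `(x, u)` suffice to see that the conjugate of `N` at `-(u, z)` is at least `- z u`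
    have := hH (x, u)
    rw [hg] at this
    have h2 : -(u x + z u) + (δ - N (x, u)) ≤ c / s := by
      rw [le_div_iff₀ hs]
      linarith
    simp only [N] at h2
    simp only [neg_apply]
    linarith
  have : 2 * a * (1 / (2 * a) * ‖u‖ ^ 2) = ‖u‖ ^ 2 := by field_simp
  rw [norm_neg] at hnorm
  have h3 : 2 * a * (c / s - δ + z u) < 0 := mul_neg_of_pos_of_neg (by positivity) (by linarith)
  linarith

/-- If `P` and `Q` are close to each other then `P²` is close to the mean of `P²` and `Q²`. -/
lemma sq_le_of_sum_sq_le {P Q ε η δ : ℝ} (hη : 0 < η)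
    (hδ : 2 * δ * (ε + 2 * η) ≤ η ^ 2) (hsum : P ^ 2 + Q ^ 2 ≤ 2 * (ε + 2 * η))
    (hdiff : (P - Q) ^ 2 ≤ 2 * δ) : P ^ 2 ≤ ε + 3 * η := by
  have hprod : ((P - Q) * (P + Q) / 2) ^ 2 ≤ η ^ 2 := by
    have h1 : (P + Q) ^ 2 ≤ 4 * (ε + 2 * η) := by nlinarith [sq_nonneg (P - Q)]
    have h2 := mul_le_mul hdiff h1 (sq_nonneg _) ((sq_nonneg _).trans hdiff)
    linarith
  have := (abs_le_of_sq_le_sq' hprod hη.le).2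
  linarith

/-- If the origin is in the `ε`-enlargement of `T`, then there are points of the `δ`-enlargement, for
`δ` as small as desired, at a weighted distance from the origin that is close to `√ε`. -/
lemma IsNI.exists_near_zero {T : Set (X × StrongDual ℝ X)} (hT : IsNI T)
    (hm : IsMonotone pairing T) {a ε η δ : ℝ} (ha : 0 < a) (hε : 0 ≤ ε) (hη : 0 < η) (hδ : 0 < δ)
    (h0 : ∀ q ∈ T, -ε ≤ q.2 q.1) :
    ∃ p : X × StrongDual ℝ X, (∀ q ∈ T, -δ ≤ (p.2 - q.2) (p.1 - q.1)) ∧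
      (√a * ‖p.1‖) ^ 2 ≤ ε + 3 * η ∧ (‖p.2‖ / √a) ^ 2 ≤ ε + 3 * η := by
  obtain ⟨κ, hκ0, hκδ, hκ⟩ : ∃ κ : ℝ, 0 < κ ∧ κ ≤ δ ∧ 2 * κ * (ε + 2 * η) ≤ η ^ 2 := by
    have hpos : 0 < 2 * (ε + 2 * η) := by positivity
    refine ⟨min δ (η ^ 2 / (2 * (ε + 2 * η))), lt_min hδ (by positivity), min_le_left _ _, ?_⟩
    have := (le_div_iff₀ hpos).1 (min_le_right δ (η ^ 2 / (2 * (ε + 2 * η))))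
    linarith
  obtain ⟨⟨x, u⟩, hp⟩ := hT.exists_fitzpatrick_add_sq_norm_le hm ha hκ0
  have hsq := Real.sqrt_pos.2 ha
  have hsa := Real.sq_sqrt ha.le
  set P : ℝ := √a * ‖x‖ with hP
  set Q : ℝ := ‖u‖ / √a with hQ
  have hA : a / 2 * ‖x‖ ^ 2 + 1 / (2 * a) * ‖u‖ ^ 2 = (P ^ 2 + Q ^ 2) / 2 := by
    rw [hP, hQ, mul_pow, div_pow, hsa]
    field_simp
  have hPQ : |u x| ≤ P * Q := by
    have h := u.le_opNorm x
    rw [Real.norm_eq_abs] at h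
    refine h.trans_eq ?_
    rw [hP, hQ]
    field_simp
  have hP0 : 0 ≤ P := by positivity
  have hQ0 : 0 ≤ Q := by positivity
  simp only [hA] at hp
  have hlow : u x + (P ^ 2 + Q ^ 2) / 2 ≤ κ := by
    have := hT u (NormedSpace.inclusionInDoubleDual ℝ X x) (κ - (P ^ 2 + Q ^ 2) / 2) fun q hq => by
      have := hp q hq
      simp only [NormedSpace.dual_def]
      linarith
    simp only [NormedSpace.dual_def] at this
    linarith
  have hux := abs_le.1 hPQ
  have hdiff : (P - Q) ^ 2 ≤ 2 * κ := by nlinarith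
  -- on the segment from the origin to `(x, u)` the Fitzpatrick function is at most the linear
  -- interpolation of its values at the ends, and at least the duality product `t² u x`
  have hseg : ∀ t : ℝ, 0 < t → t < 1 →
      t * (1 - t) * ((P ^ 2 + Q ^ 2) / 2) ≤ (1 - t) * ε + t * κ := by
    intro t ht0 ht1
    have := hT (t • u) (NormedSpace.inclusionInDoubleDual ℝ X (t • x))
      ((1 - t) * ε + t * (κ - (P ^ 2 + Q ^ 2) / 2)) fun q hq => by
        have e1 := mul_le_mul_of_nonneg_left (hp q hq) ht0.le
        have e2 := mul_le_mul_of_nonneg_left (h0 q hq) (sub_nonneg.2 ht1.le)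
        simp only [NormedSpace.dual_def, smul_apply, map_smul, smul_eq_mul]
          at e1 ⊢
        linarith
    simp only [NormedSpace.dual_def, smul_apply, map_smul, smul_eq_mul] at this
    nlinarith [mul_pos ht0 ht0, sq_nonneg (P - Q)]
  have hsum : P ^ 2 + Q ^ 2 ≤ 2 * (ε + 2 * η) := by
    have hpos : 0 < ε + 2 * η := by positivity
    -- `t` is close to `1`, and at this `t` one has `ε / t ≤ ε + η` and `κ / (1 - t) ≤ η`
    have := hseg ((ε + η) / (ε + 2 * η)) (by positivity) (by rw [div_lt_one hpos]; linarith)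
    have e : 1 - (ε + η) / (ε + 2 * η) = η / (ε + 2 * η) := by field_simp; ring
    rw [e] at this
    have h2 := mul_le_mul_of_nonneg_left this (sq_nonneg (ε + 2 * η))
    have e3 : (ε + 2 * η) ^ 2 * ((ε + η) / (ε + 2 * η) * (η / (ε + 2 * η)) * ((P ^ 2 + Q ^ 2) / 2))
      = (ε + η) * η * ((P ^ 2 + Q ^ 2) / 2) := by field_simp
    have e4 : (ε + 2 * η) ^ 2 * (η / (ε + 2 * η) * ε + (ε + η) / (ε + 2 * η) * κ)
      = (ε + 2 * η) * (η * ε) + (ε + η) * ((ε + 2 * η) * κ) := by field_simp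
    rw [e3, e4] at h2
    have h5 : (ε + η) * ((ε + 2 * η) * κ) ≤ (ε + η) * (η ^ 2) := by
      gcongr
      nlinarith [mul_pos hpos hκ0]
    have h6 : (ε + η) * η * ((P ^ 2 + Q ^ 2) / 2) ≤ (ε + η) * η * (ε + 2 * η) := by
      nlinarith [mul_pos hη (mul_pos hη hη)]
    have := le_of_mul_le_mul_left h6 (by positivity)
    linarith
  have hdiff' : (Q - P) ^ 2 ≤ 2 * κ := by linarith
  refine ⟨(x, u), fun q hq => ?_, sq_le_of_sum_sq_le hη hκ hsum hdiff,
    sq_le_of_sum_sq_le (Q := P) hη hκ (by linarith) hdiff'⟩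
  have := hp q hq
  simp only [map_sub, sub_apply] at this ⊢
  nlinarith [sq_nonneg (P - Q)]

lemma IsNI.translate {T : Set (X × StrongDual ℝ X)} (hT : IsNI T) (p : X × StrongDual ℝ X) :
    IsNI {q | q + p ∈ T} := by
  intro u z c hc
  have := hT (u + p.2) (z + NormedSpace.inclusionInDoubleDual ℝ X p.1)
    (c + u p.1 + z p.2 + p.2 p.1) fun q hq => by
      have := hc (q - p) (by simpa using hq)
      simp only [Prod.fst_sub, Prod.snd_sub, map_sub, sub_apply,
        add_apply, NormedSpace.dual_def] at this ⊢
      linarith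
  simp only [map_add, add_apply, NormedSpace.dual_def] at this
  linarith

lemma IsNI.exists_near {T : Set (X × StrongDual ℝ X)} (hT : IsNI T)
    (hm : IsMonotone pairing T) {a ε η δ : ℝ} (ha : 0 < a) (hε : 0 ≤ ε) (hη : ε < η) (hδ : 0 < δ)
    {p : X × StrongDual ℝ X} (hp : p.2 ∈ enlargement T ε p.1) :
    ∃ p' : X × StrongDual ℝ X, p'.2 ∈ enlargement T δ p'.1 ∧
      √a * dist p.1 p'.1 ≤ √η ∧ dist p.2 p'.2 / √a ≤ √η := by
  obtain ⟨d, hd, h1, h2⟩ := (hT.translate p).exists_near_zero (η := (η - ε) / 3) (fun q hq r hr => by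
      simpa using hm _ hq _ hr) ha hε (by linarith) hδ fun q hq => by
        have := hp _ hq
        simpa [pairing] using this
  have e : ε + 3 * ((η - ε) / 3) = η := by ring
  rw [e] at h1 h2
  refine ⟨d + p, fun q hq => ?_, ?_, ?_⟩
  · have := hd (q - p) (by simpa using hq)
    simp only [pairing]
    convert this using 2 <;> simp only [Prod.fst_sub, Prod.snd_sub, Prod.fst_add, Prod.snd_add]
      <;> abel_nf
  · simpa [dist_eq_norm] using Real.le_sqrt_of_sq_le h1
  · simpa [dist_eq_norm] using Real.le_sqrt_of_sq_le h2

/-- Iteration of `IsNI.exists_near`: the `n`-th step goes from an enlargement with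
`ε = (r / 2ⁿ⁺¹)² / 2` to the next one and has weighted length at most `r / 2ⁿ⁺¹`, so that the whole
way has length at most `r`. -/
lemma IsNI.exists_mem_near [CompleteSpace X] {T : Set (X × StrongDual ℝ X)} (hT : IsNI T)
    (hm : IsMaximalMonotone pairing T) {a r : ℝ} (ha : 0 < a) (hr : 0 < r)
    {p : X × StrongDual ℝ X} (hp : p.2 ∈ enlargement T (r ^ 2 / 8) p.1) :
    ∃ p' ∈ T, √a * dist p.1 p'.1 ≤ r ∧ dist p.2 p'.2 / √a ≤ r := by
  have hsq := Real.sqrt_pos.2 ha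
  let ρ : ℕ → ℝ := fun n => (r / 2 / 2 ^ n) ^ 2 / 2
  have hρ : ∀ n, 0 < ρ n := fun n => by positivity
  choose! F hF1 hF2 hF3 using fun (n : ℕ) (p : X × StrongDual ℝ X)
    (hp : p.2 ∈ enlargement T (ρ n) p.1) =>
      hT.exists_near hm.prop ha (hρ n).le (η := (r / 2 / 2 ^ n) ^ 2) (half_lt_self (by positivity))
        (hρ (n + 1)) hp
  let s : ℕ → X × StrongDual ℝ X := fun n => Nat.rec p (fun n q => F n q) n
  have hs : ∀ n, (s n).2 ∈ enlargement T (ρ n) (s n).1 := by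
    intro n
    induction n with
    | zero =>
      have : ρ 0 = r ^ 2 / 8 := by simp only [ρ]; ring
      rw [this]
      exact hp
    | succ n ih => exact hF1 n _ ih
  have hb1 : ∀ n, dist (s n).1 (s (n + 1)).1 ≤ r / √a / 2 / 2 ^ n := by
    intro n
    have := hF2 n _ (hs n)
    rw [Real.sqrt_sq (by positivity), mul_comm, ← le_div_iff₀ hsq] at this
    refine this.trans_eq ?_
    field_simp
  have hb2 : ∀ n, dist (s n).2 (s (n + 1)).2 ≤ r * √a / 2 / 2 ^ n := by
    intro n
    have := hF3 n _ (hs n)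
    rw [Real.sqrt_sq (by positivity), div_le_iff₀ hsq] at this
    refine this.trans_eq ?_
    field_simp
  obtain ⟨x, hx⟩ := cauchySeq_tendsto_of_complete (cauchySeq_of_le_geometric_two hb1)
  obtain ⟨u, hu⟩ := cauchySeq_tendsto_of_complete (cauchySeq_of_le_geometric_two hb2)
  refine ⟨(x, u), mem_of_forall_nonneg hm fun q hq => ?_, ?_, ?_⟩
  · have hlim : Tendsto (fun n => ((s n).2 - q.2) ((s n).1 - q.1)) atTop
        (𝓝 ((u - q.2) (x - q.1))) :=
      (isBoundedBilinearMap_apply.continuous.tendsto (u - q.2, x - q.1)).comp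
        ((hu.sub tendsto_const_nhds).prodMk_nhds (hx.sub tendsto_const_nhds))
    have hρ0 : Tendsto (fun n => -ρ n) atTop (𝓝 0) := by
      have h1 : Tendsto (fun n : ℕ => r / 2 / 2 ^ n) atTop (𝓝 0) :=
        tendsto_const_nhds.div_atTop (tendsto_pow_atTop_atTop_of_one_lt one_lt_two)
      simpa using ((h1.pow 2).div_const 2).neg
    exact le_of_tendsto_of_tendsto' hρ0 hlim fun n => hs n q hq
  · have := dist_le_of_le_geometric_two_of_tendsto₀ hb1 hx
    rwa [le_div_iff₀ hsq, mul_comm] at this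
  · have := dist_le_of_le_geometric_two_of_tendsto₀ hb2 hu
    rwa [← div_le_iff₀ hsq] at this

lemma IsNI.hasRestrictedBRProperty [CompleteSpace X] {T : Set (X × StrongDual ℝ X)} (hT : IsNI T)
    (hm : IsMaximalMonotone pairing T) : HasRestrictedBRProperty T := by
  intro ε hε x u hu ε' hε' l hl
  have hε'0 : 0 < ε' := hε.trans_lt hε'
  let a : ℝ := ε' / l ^ 2
  have ha : 0 < a := by positivity
  have hsa : √a = √ε' / l := by
    rw [Real.sqrt_div hε'0.le, Real.sqrt_sq hl.le]
  have hsq : 0 < √ε' := Real.sqrt_pos.2 hε'0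
  -- one step of length at most `√η`, followed by a way of length at most `r < √ε' - √η`
  let η : ℝ := (ε + ε') / 2
  have hη : √η < √ε' := Real.sqrt_lt_sqrt (by positivity) (by simp only [η]; linarith)
  let r : ℝ := (√ε' - √η) / 2
  have hr : 0 < r := by simp only [r]; linarith
  obtain ⟨p, hp, h1, h2⟩ := hT.exists_near hm.prop (p := (x, u)) (η := η) (δ := r ^ 2 / 8) ha hε
    (by simp only [η]; linarith) (by positivity) hu
  obtain ⟨p', hp', h3, h4⟩ := hT.exists_mem_near hm ha hr hp
  refine ⟨p', hp', ?_, ?_⟩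
  · have h5 : √a * dist x p'.1 < √ε' := by
      have := mul_le_mul_of_nonneg_left (dist_triangle x p.1 p'.1) (Real.sqrt_nonneg a)
      simp only [r] at h3
      linarith
    rw [hsa, div_mul_eq_mul_div, div_lt_iff₀ hl] at h5
    rw [← dist_eq_norm]
    exact lt_of_mul_lt_mul_left h5 hsq.le
  · have h5 : dist u p'.2 / √a < √ε' := by
      have := div_le_div_of_nonneg_right (dist_triangle u p.2 p'.2) (Real.sqrt_nonneg a)
      rw [add_div] at this
      simp only [r] at h4
      linarith
    rw [hsa, div_lt_iff₀ (by positivity), ← mul_div_assoc, Real.mul_self_sqrt hε'0.le] at h5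
    rw [← dist_eq_norm, dist_comm]
    exact h5

end BidualExtensionProof

end BidualExtension

open BidualExtension
theorem theorem1 {X : Type*} [NormedAddCommGroup X] [NormedSpace ℝ X] [CompleteSpace X]
    (T : Set (X × StrongDual ℝ X)) (hT : IsMaximalMonotone pairing T)
    (hS : ∀ (u : StrongDual ℝ X) (z : StrongDual ℝ (StrongDual ℝ X)),
      ((pairing u z : ℝ) : EReal) ≤ prodConjugate (sFun T) (u, z)) :
    (∃! T' : Set (StrongDual ℝ (StrongDual ℝ X) × StrongDual ℝ X),
      IsMaximalMonotoneExtension T T') ∧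
    (∀ T' : Set (StrongDual ℝ (StrongDual ℝ X) × StrongDual ℝ X),
      IsMaximalMonotoneExtension T T' →
        prodConjugate (sFun T) = fitzpatrickFun (lam T') ∧
        ∀ h ∈ fitzpatrickFamily T, prodConjugate h ∈ fitzpatrickFamily (lam T')) ∧
    (∀ h ∈ fitzpatrickFamily T, ∀ (u : StrongDual ℝ X) (z : StrongDual ℝ (StrongDual ℝ X)),
      ((pairing u z : ℝ) : EReal) ≤ prodConjugate h (u, z)) ∧
    HasRestrictedBRProperty T := by
  have hNI : IsNI T := isNI_of_le_prodConjugate hS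
  have hext := hNI.isMaximalMonotoneExtension_iff hT.prop
  refine ⟨⟨bidualRelated T, (hext _).2 rfl, fun A hA => (hext A).1 hA⟩, fun T' hT' => ?_,
    fun h hh => pairing_le_prodConjugate hS hh, hNI.hasRestrictedBRProperty hT⟩
  obtain rfl := (hext T').1 hT'
  exact ⟨hNI.prodConjugate_sFun_eq hT.prop, fun h hh =>
    hNI.prodConjugate_mem_fitzpatrickFamily hh (pairing_le_prodConjugate hS hh)⟩
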